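/- Label the vertices of the $2\times n$ grid graph column by column, so that its edges are $\{2i-1,2i\}$ for $1\le i\le n$ and $\{k,k+2\}$ for $1\le k\le 2n-2$. For a finite simple graph $G=(V,E)$ let $|G\rangle=\prod_{\{i,j\}\in E}CZ_{ij}\,|+\rangle^{\otimes V}$ be its graph state. Local complementation at a vertex $v$ replaces $E$ by its symmetric difference with the edge set of the complete graph on the neighbours of $v$; two graphs are locally equivalent if a sequence of local complementations turns one into the other; $H$ is a vertex-minor of $G$ if a sequence of local complementations and vertex deletions turns $G$ into $H$. Two pairs of vertices cross in a graph if every path connecting the first pair has a common edge with every path connecting the second pair. Bell pairs between $a,b$ and between $c,d$ can be extracted simultaneously from a state if an adaptive protocol of single-qubit Clifford operations, single-qubit Pauli measurements and classical communication turns it, whatever the measurement outcomes, into the product of a Bell state of $a,b$, a Bell state of $c,d$, and some state of the remaining qubits. (1) The $2\times4$ grid graph is locally equivalent to a ring graph $R$ on the same 8 vertices in which the pairs $1,8$ and $2,7$ cross; the graph states of the grid and of $R$ are equivalent under single-qubit Clifford operations. (2) Simultaneous extraction of Bell pairs between $1,8$ and $2,7$ from the $2\times4$ grid is impossible: the graph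 with vertices $1,2,7,8$ and edges $\{1,8\},\{2,7\}$ is not a vertex-minor of the grid; Bell pairs between $1,8$ and $2,7$ cannot be extracted simultaneously from its graph state; and, not even probabilistically, no product operator $\bigotimes_v K_v$ with arbitrary $2\times 2$ complex matrices $K_v$ maps its graph state to a nonzero multiple of a product of Bell states of $1,8$ and of $2,7$ and a state of the remaining qubits. (3) In contrast, for the butterfly network (the $2\times3$ grid) and the pairs $1,6$ and $2,5$, the graph with vertices $1,2,5,6$ and edges $\{1,6\},\{2,5\}$ is a vertex-minor of the grid, and Bell pairs between $1,6$ and $2,5$ can be extracted simultaneously from its graph state. -/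

import Mathlib

open scoped Matrix

namespace QNet

/-! ### Graphs: local complementation, vertex-minors, grids and rings -/

/-- Local complementation at `v`: the edges among the neighbours of `v` are complemented
(the edge set becomes its symmetric difference with the complete graph on `N_v`). -/
def localComplement {V : Type*} (G : SimpleGraph V) (v : V) : SimpleGraph V where
  Adj a b := a ≠ b ∧ Xor (G.Adj a b) (G.Adj v a ∧ G.Adj v b)
  symm := ⟨fun a b h => ⟨h.1.symm, by
    have h2 := h.2
    rw [G.adj_comm b a, and_comm (a := G.Adj v b)]
    exact h2⟩⟩
  loopless := ⟨fun _ h => h.1 rfl⟩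

/-- Two graphs on the same vertices are locally equivalent if a finite sequence of local
complementations maps one to the other (each local complementation is an involution). -/
def LocallyEquivalent {V : Type*} (G H : SimpleGraph V) : Prop :=
  Relation.ReflTransGen (fun A B => ∃ v, B = localComplement A v) G H

/-- `IsVertexMinor G S H`: the graph with vertex set `S` and edge set that of `H` is obtained from
`G` by a sequence of local complementations and vertex deletions.  A graph on a subset `S` of `V` is
represented by the pair of `S` and a graph on `V` all of whose edges lie inside `S`; deleting `v`
removes `v` from the vertex set together with all edges at `v`. -/
inductive IsVertexMinor {V : Type*} (G : SimpleGraph V) : Set V → SimpleGraph V → Prop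
  | refl : IsVertexMinor G Set.univ G
  | complement {S : Set V} {H : SimpleGraph V} (v : V) (hv : v ∈ S)
      (h : IsVertexMinor G S H) : IsVertexMinor G S (localComplement H v)
  | delete {S : Set V} {H : SimpleGraph V} (v : V) (hv : v ∈ S)
      (h : IsVertexMinor G S H) : IsVertexMinor G (S \ {v}) (H.deleteIncidenceSet v)

/-- The graph consisting of the two edges `ab` and `cd`: its graph state is, up to single-qubit
Clifford operations, a pair of Bell pairs. -/
def twoEdges {V : Type*} (a b c d : V) : SimpleGraph V :=
  SimpleGraph.fromEdgeSet {s(a, b), s(c, d)}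

/-- The `2 × n` grid graph.  The vertex `(i, j)` (column `i`, row `j`, both counted from `0`) has
the label `2 * i + j + 1`, so the labels run from `1` to `2 * n`, column by column. -/
def grid (n : ℕ) : SimpleGraph (Fin n × Fin 2) :=
  SimpleGraph.boxProd (SimpleGraph.pathGraph n) (SimpleGraph.pathGraph 2)

/-- `R` is a ring graph on `n` vertices (used for `3 ≤ n`). -/
def IsRing {V : Type*} (n : ℕ) (R : SimpleGraph V) : Prop :=
  Nonempty (SimpleGraph.cycleGraph n ≃g R)

/-- The pairs `a, b` and `c, d` cross in `G`: every path connecting `a` with `b` has a common edge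
with every path connecting `c` with `d`. -/
def PairsCross {V : Type*} (G : SimpleGraph V) (a b c d : V) : Prop :=
  ∀ (p : G.Walk a b) (q : G.Walk c d), p.IsPath → q.IsPath → ∃ e, e ∈ p.edges ∧ e ∈ q.edges

/-! ### States of qubits and local operations -/

/-- (Not necessarily normalized) vectors in `(ℂ²)^{⊗ V}`, given by their amplitudes in the
computational basis. -/
abbrev QState (V : Type*) := (V → Fin 2) → ℂ

/-- The diagonal entry of the controlled-`Z` gate on the pair of qubits `e` at the basis
state `x`: it is `-1` if both qubits are `1`, and `1` otherwise. -/
noncomputable def czEntry {V : Type*} (e : Sym2 V) (x : V → Fin 2) : ℂ :=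
  open Classical in if ∀ v ∈ e, x v = 1 then -1 else 1

/-- The graph state `|G⟩ = ∏_{e ∈ E} CZ_e |+⟩^{⊗ V}`; every amplitude of `|+⟩^{⊗ V}` is
`(1 / √2) ^ |V|`, and the controlled-`Z` gates are diagonal. -/
noncomputable def graphState {V : Type*} [Fintype V] (G : SimpleGraph V) : QState V :=
  open Classical in
  fun x => (∏ e ∈ G.edgeFinset, czEntry e x) * ((1 / Real.sqrt 2 : ℝ) : ℂ) ^ Fintype.card V

/-- The operator `⨂_v K v` on `(ℂ²)^{⊗ V}`. -/
def localOp {V : Type*} [Fintype V] (K : V → Matrix (Fin 2) (Fin 2) ℂ) :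
    Matrix (V → Fin 2) (V → Fin 2) ℂ :=
  Matrix.of fun x y => ∏ v, K v (x v) (y v)

/-- The single-qubit operator `A` applied to qubit `v` of the state `ψ`. -/
def applyAt {V : Type*} [Fintype V] [DecidableEq V] (v : V) (A : Matrix (Fin 2) (Fin 2) ℂ)
    (ψ : QState V) : QState V :=
  localOp (Function.update (fun _ => 1) v A) *ᵥ ψ

/-- The three Pauli matrices `X`, `Y`, `Z`. -/
def paulis : Set (Matrix (Fin 2) (Fin 2) ℂ) :=
  {!![0, 1; 1, 0], !![0, -Complex.I; Complex.I, 0], !![1, 0; 0, -1]}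

/-- Single-qubit Clifford operations: unitaries that map Pauli matrices to Pauli matrices, up to
sign, under conjugation. -/
def IsClifford (U : Matrix (Fin 2) (Fin 2) ℂ) : Prop :=
  U ∈ Matrix.unitaryGroup (Fin 2) ℂ ∧
    ∀ P ∈ paulis, U * P * Uᴴ ∈ paulis ∨ -(U * P * Uᴴ) ∈ paulis

/-- Two states are equivalent under single-qubit Clifford operations (global phases are themselves
Clifford operations). -/
def LocalCliffordEquivalent {V : Type*} [Fintype V] [DecidableEq V]
    (ψ φ : QState V) : Prop :=
  ∃ U : V → Matrix (Fin 2) (Fin 2) ℂ, (∀ v, IsClifford (U v)) ∧ localOp U *ᵥ ψ = φ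

/-- The (unnormalized) state after measuring the Pauli observable `P` on qubit `v` with outcome
`s = ±1`; it is nonzero exactly when the outcome has positive probability. -/
noncomputable def afterMeasurement {V : Type*} [Fintype V] [DecidableEq V] (v : V)
    (P : Matrix (Fin 2) (Fin 2) ℂ) (s : ℤˣ) (ψ : QState V) : QState V :=
  applyAt v ((1 / 2 : ℂ) • (1 + ((s : ℤ) : ℂ) • P)) ψ

/-- `LocallyYields T ψ`: there is a protocol made of single-qubit Clifford operations,
single-qubit Pauli measurements and classical communication (every step may depend on all
earlier outcomes) that turns `ψ` into a state satisfying `T`, whatever the outcomes are. -/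
inductive LocallyYields {V : Type*} [Fintype V] [DecidableEq V] (T : QState V → Prop) :
    QState V → Prop
  | done {ψ : QState V} (h : T ψ) : LocallyYields T ψ
  | clifford {ψ : QState V} (v : V) (U : Matrix (Fin 2) (Fin 2) ℂ) (hU : IsClifford U)
      (h : LocallyYields T (applyAt v U ψ)) : LocallyYields T ψ
  | measure {ψ : QState V} (v : V) (P : Matrix (Fin 2) (Fin 2) ℂ) (hP : P ∈ paulis)
      (h : ∀ s : ℤˣ, afterMeasurement v P s ψ ≠ 0 → LocallyYields T (afterMeasurement v P s ψ)) :
      LocallyYields T ψ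

/-- Amplitudes of the Bell state `(|00⟩ + |11⟩) / √2`. -/
noncomputable def bell (i j : Fin 2) : ℂ := if i = j then ((1 / Real.sqrt 2 : ℝ) : ℂ) else 0

/-- The nonzero state `ψ` is, up to normalization, a Bell state of `a, b`, times a Bell state of
`c, d`, times some state `χ` of the other qubits. -/
def HasBellPairs {V : Type*} (a b c d : V) (ψ : QState V) : Prop :=
  ∃ χ : QState {v : V // v ≠ a ∧ v ≠ b ∧ v ≠ c ∧ v ≠ d}, χ ≠ 0 ∧
    ∀ x : V → Fin 2, ψ x = bell (x a) (x b) * bell (x c) (x d) * χ (fun v => x v)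

/-- Bell pairs between `a, b` and between `c, d` can be extracted simultaneously from `ψ` by local
Clifford operations, local Pauli measurements and classical communication. -/
def BellPairsExtractable {V : Type*} [Fintype V] [DecidableEq V] (a b c d : V) (ψ : QState V) :
    Prop :=
  LocallyYields (HasBellPairs a b c d) ψ

end QNet

open QNet

namespace QNet

/-! ### Local operators -/

section LocalOp

variable {V : Type*} [Fintype V]

/-! Graph operations are realized by local operations on graph states. Local complementation is a
product of single-qubit Cliffords (`localOp_complementOp`). Vertex deletion is a `Z` measurement
followed by `Z` corrections on the neighbours. Hence a vertex-minor consisting of two disjoint edges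
gives an extraction protocol (`IsVertexMinor.bellPairsExtractable`), which settles the butterfly.

For the impossibility, every branch of a protocol is a product operator `localOp K`, so it suffices
to exclude all such `K`. Being Clifford equivalent, the grid state may be replaced by the state of
the ring. There, removing the qubits 2 and 7 separates 1 from 8, so for fixed values of 2 and 7 the
amplitude is a product of a function on one arc and a function on the other
(`exchangeable_graphState`). Local operators trivial on 2 and 7 preserve this
(`Exchangeable.localOp`). An operator producing a Bell pair on 2, 7 is invertible at both, so its
factors there can be undone while the Bell pair on 1, 8 stays. Such a state has no product form
across the two arcs (`not_hasBellPairs_of_exchangeable`). -/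

theorem localOp_mul [DecidableEq V] (A B : V → Matrix (Fin 2) (Fin 2) ℂ) :
    localOp A * localOp B = localOp (fun v => A v * B v) := by
  ext x z
  simp only [localOp, Matrix.mul_apply, Matrix.of_apply, ← Finset.prod_mul_distrib]
  rw [Finset.prod_univ_sum]
  simp

theorem localOp_mulVec_mulVec [DecidableEq V] (A B : V → Matrix (Fin 2) (Fin 2) ℂ)
    (ψ : QState V) :
    localOp A *ᵥ (localOp B *ᵥ ψ) = localOp (fun v => A v * B v) *ᵥ ψ := by
  rw [Matrix.mulVec_mulVec, localOp_mul]

theorem localOp_diagonal [DecidableEq V] (d : V → Fin 2 → ℂ) (ψ : QState V) (x : V → Fin 2) :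
    (localOp (fun v => Matrix.diagonal (d v)) *ᵥ ψ) x = (∏ v, d v (x v)) * ψ x := by
  simp only [localOp, Matrix.mulVec, dotProduct, Matrix.of_apply]
  rw [Finset.sum_eq_single x]
  · simp
  · intro y _ hy
    obtain ⟨v, hv⟩ := Function.ne_iff.mp hy
    have h0 : Matrix.diagonal (d v) (x v) (y v) = 0 := Matrix.diagonal_apply_ne _ hv.symm
    exact mul_eq_zero_of_left (Finset.prod_eq_zero (Finset.mem_univ v) h0) _
  · simp

theorem localOp_one [DecidableEq V] (ψ : QState V) :
    localOp (fun _ => 1) *ᵥ ψ = ψ := by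
  ext x
  simp_rw [← Matrix.diagonal_one]
  rw [localOp_diagonal (fun _ _ => 1)]
  simp

theorem applyAt_apply [DecidableEq V] (v : V) (A : Matrix (Fin 2) (Fin 2) ℂ) (ψ : QState V)
    (x : V → Fin 2) :
    applyAt v A ψ x = ∑ i, A (x v) i * ψ (Function.update x v i) := by
  simp only [applyAt, localOp, Matrix.mulVec, dotProduct, Matrix.of_apply]
  symm
  refine Finset.sum_of_injOn (fun i => Function.update x v i)
    (fun i _ j _ h => by simpa using congrFun h v) (by simp) ?_ ?_
  · intro y _ hy
    have : ∃ w, w ≠ v ∧ x w ≠ y w := by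
      by_contra! h
      refine hy ⟨y v, by simp, ?_⟩
      ext w
      by_cases hw : w = v
      · subst hw; simp
      · simp [hw, h w hw]
    obtain ⟨w, hw, hxy⟩ := this
    rw [Finset.prod_eq_zero (Finset.mem_univ w), zero_mul]
    rw [Function.update_of_ne hw, Matrix.one_apply_ne hxy]
  · intro i _
    congr 1
    rw [Finset.prod_eq_single v]
    · simp
    · intro w _ hw
      simp [hw]
    · simp

theorem applyAt_localOp [DecidableEq V] (v : V) (A : Matrix (Fin 2) (Fin 2) ℂ)
    (K : V → Matrix (Fin 2) (Fin 2) ℂ) (ψ : QState V) :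
    applyAt v A (localOp K *ᵥ ψ) = localOp (Function.update K v (A * K v)) *ᵥ ψ := by
  rw [applyAt, localOp_mulVec_mulVec]
  congr 2
  ext1 w
  by_cases hw : w = v
  · subst hw; simp
  · simp [hw]

end LocalOp

/-! ### Clifford operations -/

section Clifford

theorem IsClifford.mul {A B : Matrix (Fin 2) (Fin 2) ℂ} (hA : IsClifford A) (hB : IsClifford B) :
    IsClifford (A * B) := by
  refine ⟨mul_mem hA.1 hB.1, fun P hP => ?_⟩
  have h : A * B * P * (A * B)ᴴ = A * (B * P * Bᴴ) * Aᴴ := by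
    simp only [Matrix.conjTranspose_mul, Matrix.mul_assoc]
  rw [h]
  rcases hB.2 P hP with h1 | h1
  · exact hA.2 _ h1
  · rcases hA.2 _ h1 with h2 | h2
    · right; simpa using h2
    · left; simpa using h2

theorem isClifford_one : IsClifford 1 :=
  ⟨one_mem _, fun P hP => by simp [hP]⟩

theorem isClifford_of {U X' Y' Z' : Matrix (Fin 2) (Fin 2) ℂ} (hU : U * Uᴴ = 1)
    (hX : U * !![0, 1; 1, 0] * Uᴴ = X')
    (hY : U * !![0, -Complex.I; Complex.I, 0] * Uᴴ = Y')
    (hZ : U * !![1, 0; 0, -1] * Uᴴ = Z')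
    (hX' : X' ∈ paulis ∨ -X' ∈ paulis) (hY' : Y' ∈ paulis ∨ -Y' ∈ paulis)
    (hZ' : Z' ∈ paulis ∨ -Z' ∈ paulis) : IsClifford U := by
  refine ⟨Matrix.mem_unitaryGroup_iff.mpr hU, fun P hP => ?_⟩
  rcases hP with rfl | rfl | rfl
  · rwa [hX]
  · rwa [hY]
  · rwa [hZ]

/-- A square root of `X`, up to a phase. -/
noncomputable def sqrtX : Matrix (Fin 2) (Fin 2) ℂ :=
  ((1 + Complex.I) / 2) • !![1, -Complex.I; -Complex.I, 1]

/-- The Hadamard gate. -/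
noncomputable def hadamard : Matrix (Fin 2) (Fin 2) ℂ :=
  ((1 / Real.sqrt 2 : ℝ) : ℂ) • !![1, 1; 1, -1]

theorem isClifford_sqrtX : IsClifford sqrtX := by
  have hI := Complex.I_sq
  have h2 : (starRingEnd ℂ) 2 = 2 := map_ofNat _ 2
  refine isClifford_of (X' := !![0, 1; 1, 0]) (Y' := !![1, 0; 0, -1])
    (Z' := -!![0, -Complex.I; Complex.I, 0]) ?_ ?_ ?_ ?_
    (by simp [paulis]) (by simp [paulis]) (by simp [paulis]) <;>
  · ext i j
    fin_cases i <;> fin_cases j <;>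
      simp [sqrtX, Matrix.mul_apply, Matrix.conjTranspose_apply, Fin.sum_univ_two] <;>
      grind

theorem isClifford_phase : IsClifford (Matrix.diagonal ![1, -Complex.I]) := by
  refine isClifford_of (X' := -!![0, -Complex.I; Complex.I, 0]) (Y' := !![0, 1; 1, 0])
    (Z' := !![1, 0; 0, -1]) ?_ ?_ ?_ ?_
    (by simp [paulis]) (by simp [paulis]) (by simp [paulis]) <;>
  · ext i j
    fin_cases i <;> fin_cases j <;>
      simp [Matrix.mul_apply, Fin.sum_univ_two]

theorem isClifford_pauliZ : IsClifford (Matrix.diagonal ![1, -1]) := by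
  refine isClifford_of (X' := -!![0, 1; 1, 0]) (Y' := -!![0, -Complex.I; Complex.I, 0])
    (Z' := !![1, 0; 0, -1]) ?_ ?_ ?_ ?_
    (by simp [paulis]) (by simp [paulis]) (by simp [paulis]) <;>
  · ext i j
    fin_cases i <;> fin_cases j <;>
      simp [Matrix.mul_apply, Fin.sum_univ_two]

theorem isClifford_hadamard : IsClifford hadamard := by
  have h2 : (((Real.sqrt 2 : ℝ) : ℂ))⁻¹ ^ 2 = 1 / 2 := by
    rw [inv_pow, ← Complex.ofReal_pow, Real.sq_sqrt (by norm_num)]; norm_num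
  refine isClifford_of (X' := !![1, 0; 0, -1]) (Y' := -!![0, -Complex.I; Complex.I, 0])
    (Z' := !![0, 1; 1, 0]) ?_ ?_ ?_ ?_
    (by simp [paulis]) (by simp [paulis]) (by simp [paulis]) <;>
  · ext i j
    fin_cases i <;> fin_cases j <;>
      simp [hadamard, Matrix.mul_apply, Matrix.conjTranspose_apply, Fin.sum_univ_two] <;>
      grind

end Clifford

/-! ### Signs of graph states -/

section Signs

/-- The sign that a controlled-`Z` gate gives to the basis state `|ij⟩`. -/
noncomputable def pairSign (i j : Fin 2) : ℂ := if i = 1 ∧ j = 1 then -1 else 1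

theorem czEntry_mk {V : Type*} (u w : V) (x : V → Fin 2) :
    czEntry s(u, w) x = pairSign (x u) (x w) := by
  simp [czEntry, pairSign]

theorem czEntry_mul_self {V : Type*} (e : Sym2 V) (x : V → Fin 2) :
    czEntry e x * czEntry e x = 1 := by
  unfold czEntry; split_ifs <;> norm_num

variable {V : Type*} [Fintype V]

open Classical in
/-- The sign of the amplitude of the graph state of `G` at `x`. -/
noncomputable def edgeSign (G : SimpleGraph V) (x : V → Fin 2) : ℂ :=
  ∏ e : Sym2 V, if e ∈ G.edgeSet then czEntry e x else 1

theorem graphState_apply (G : SimpleGraph V) (x : V → Fin 2) :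
    graphState G x = edgeSign G x * ((1 / Real.sqrt 2 : ℝ) : ℂ) ^ Fintype.card V := by
  classical
  rw [graphState, edgeSign, ← Finset.prod_filter]
  congr 1
  refine Finset.prod_congr ?_ fun _ _ => rfl
  ext e
  simp

open Classical in
theorem edgeSign_deleteIncidenceSet (G : SimpleGraph V) (v : V) (x : V → Fin 2) :
    edgeSign G x = edgeSign (G.deleteIncidenceSet v) x *
      ∏ w, if G.Adj v w then pairSign (x v) (x w) else 1 := by
  have h : (∏ w, if G.Adj v w then pairSign (x v) (x w) else 1) =
      ∏ e : Sym2 V, if e ∈ G.incidenceSet v then czEntry e x else 1 := by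
    rw [← Finset.prod_filter, ← Finset.prod_filter]
    have : Finset.univ.filter (fun e : Sym2 V => e ∈ G.incidenceSet v) =
        (Finset.univ.filter (fun w => G.Adj v w)).image (fun w => s(v, w)) := by
      ext e
      simp only [Finset.mem_filter, Finset.mem_univ, true_and, Finset.mem_image]
      constructor
      · rintro ⟨he, hv⟩
        obtain ⟨w, rfl⟩ := Sym2.mem_iff_exists.mp hv
        exact ⟨w, he, rfl⟩
      · rintro ⟨w, hw, rfl⟩
        exact ⟨hw, Sym2.mem_mk_left _ _⟩
    rw [this, Finset.prod_image]
    · exact Finset.prod_congr rfl fun w _ => (czEntry_mk v w x).symm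
    · intro a _ b _ hab
      exact Sym2.congr_right.mp hab
  rw [h, edgeSign, edgeSign, ← Finset.prod_mul_distrib]
  refine Finset.prod_congr rfl fun e _ => ?_
  have hm : e ∈ (G.deleteIncidenceSet v).edgeSet ↔ e ∈ G.edgeSet ∧ e ∉ G.incidenceSet v := by
    rw [SimpleGraph.edgeSet_deleteIncidenceSet]
    exact Iff.rfl
  simp only [hm]
  have := G.incidenceSet_subset v
  by_cases h1 : e ∈ G.edgeSet <;> by_cases h2 : e ∈ G.incidenceSet v
  · simp [h1, h2]
  · simp [h1, h2]
  · exact absurd (this h2) h1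
  · simp [h1, h2]

open Classical in
/-- The neighbours of `v` that carry the value `1` in the basis state `x`. -/
noncomputable def onNeighbors (G : SimpleGraph V) (v : V) (x : V → Fin 2) : Finset V :=
  Finset.univ.filter (fun w => G.Adj v w ∧ x w = 1)

-- Exactly the pairs of neighbours of `v` are toggled, and a toggled pair changes the sign only if
-- both its ends carry `1`; `choose 2` counts these pairs.
open Classical in
theorem edgeSign_localComplement (G : SimpleGraph V) (v : V) (x : V → Fin 2) :
    edgeSign (localComplement G v) x =
      edgeSign G x * (-1) ^ ((onNeighbors G v x).card.choose 2) := by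
  rw [← Sym2.card_image_offDiag, ← Finset.prod_const, ← Finset.prod_ite_mem_eq, edgeSign, edgeSign,
    ← Finset.prod_mul_distrib]
  refine Finset.prod_congr rfl fun e _ => ?_
  induction e with | _ a b => ?_
  have hm : s(a, b) ∈ (onNeighbors G v x).offDiag.image Sym2.mk.uncurry ↔
      a ≠ b ∧ (G.Adj v a ∧ G.Adj v b) ∧ (x a = 1 ∧ x b = 1) := by
    simp only [Finset.mem_image, Finset.mem_offDiag, onNeighbors, Finset.mem_filter,
      Finset.mem_univ, true_and, Prod.exists, Function.uncurry_apply_pair, Sym2.eq_iff]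
    constructor
    · rintro ⟨c, d, h, ⟨rfl, rfl⟩ | ⟨rfl, rfl⟩⟩ <;> tauto
    · rintro h
      exact ⟨a, b, by tauto, Or.inl ⟨rfl, rfl⟩⟩
  simp only [hm, SimpleGraph.mem_edgeSet, localComplement, czEntry_mk, pairSign]
  have := G.ne_of_adj (a := a) (b := b)
  by_cases hab : a = b
  · subst hab; simp
  · by_cases h1 : G.Adj a b <;> by_cases h2 : G.Adj v a ∧ G.Adj v b <;>
      by_cases h3 : x a = 1 ∧ x b = 1 <;> simp [hab, h1, h2, h3, Xor]

theorem edgeSign_congr (G : SimpleGraph V) {x y : V → Fin 2}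
    (h : ∀ u w, G.Adj u w → x u = y u) : edgeSign G x = edgeSign G y := by
  classical
  refine Finset.prod_congr rfl fun e _ => ?_
  induction e with | _ a b => ?_
  split_ifs with he
  · rw [czEntry_mk, czEntry_mk, h a b he, h b a he.symm]
  · rfl

end Signs

/-! ### Local complementation acts on graph states by local Clifford operations -/

section LocalComplement

variable {V : Type*} [Fintype V]

theorem edgeSign_update [DecidableEq V] (G : SimpleGraph V) (v : V) (x : V → Fin 2) (i : Fin 2) :
    edgeSign G (Function.update x v i) = edgeSign (G.deleteIncidenceSet v) x *
      (if i = 1 then (-1) ^ (onNeighbors G v x).card else 1) := by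
  classical
  rw [edgeSign_deleteIncidenceSet G v]
  congr 1
  · refine edgeSign_congr _ fun u w huw => ?_
    rw [SimpleGraph.deleteIncidenceSet_adj] at huw
    rw [Function.update_of_ne huw.2.1]
  · have h : ∀ w, (if G.Adj v w then
        pairSign (Function.update x v i v) (Function.update x v i w) else 1) =
        if w ∈ onNeighbors G v x then (if i = 1 then (-1 : ℂ) else 1) else 1 := by
      intro w
      by_cases hw : G.Adj v w
      · by_cases h1 : x w = 1 <;> by_cases h2 : i = 1 <;>
          simp [onNeighbors, pairSign, hw, hw.ne', h1, h2]
      · simp [onNeighbors, hw]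
    rw [Finset.prod_congr rfl fun w _ => h w, Finset.prod_ite_mem_eq, Finset.prod_const]
    split_ifs <;> simp

/-- With `s` neighbours carrying `1`, the left side is their total phase times the effect of `sqrtX`
on the qubit `v`; the right side is the sign required by `edgeSign_localComplement`. -/
theorem phase_pow_mul_sqrtX (s : ℕ) :
    (-Complex.I) ^ s * ((1 + Complex.I) / 2 * (1 - Complex.I * (-1) ^ s)) =
      (-1) ^ (s.choose 2) := by
  have hI := Complex.I_sq
  induction s with
  | zero => simp; linear_combination (-1 / 2 : ℂ) * hI
  | succ s ih =>
    have h2 : ((-1 : ℂ) ^ s) ^ 2 = 1 := by rw [← pow_mul, mul_comm, pow_mul]; norm_num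
    have hc : (-1 : ℂ) ^ (s + 1).choose 2 = (-1) ^ s * (-1) ^ s.choose 2 := by
      rw [← pow_add]; simp [Nat.choose_succ_succ]
    rw [hc, ← ih, pow_succ, pow_succ]
    linear_combination (-Complex.I) ^ s * ((1 + Complex.I) / 2) *
      (Complex.I * h2 - (-1 : ℂ) ^ s * hI)

open Classical in
/-- The local Clifford operations that realize the local complementation of `G` at `v`. -/
noncomputable def complementOp (G : SimpleGraph V) (v w : V) : Matrix (Fin 2) (Fin 2) ℂ :=
  if w = v then sqrtX else if G.Adj v w then Matrix.diagonal ![1, -Complex.I] else 1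

omit [Fintype V] in
theorem isClifford_complementOp (G : SimpleGraph V) (v w : V) :
    IsClifford (complementOp G v w) := by
  unfold complementOp
  split_ifs
  exacts [isClifford_sqrtX, isClifford_phase, isClifford_one]

theorem localOp_complementOp [DecidableEq V] (G : SimpleGraph V) (v : V) :
    localOp (complementOp G v) *ᵥ graphState G = graphState (localComplement G v) := by
  classical
  have hsplit : localOp (complementOp G v) *ᵥ graphState G =
      localOp (fun w => Matrix.diagonal (if G.Adj v w then ![1, -Complex.I] else 1)) *ᵥ
        applyAt v sqrtX (graphState G) := by
    rw [applyAt, localOp_mulVec_mulVec]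
    congr 2
    ext1 w
    by_cases hw : w = v
    · subst hw; simp [complementOp]
    · by_cases h : G.Adj v w <;> simp [complementOp, hw, h]
  rw [hsplit]
  ext x
  rw [localOp_diagonal, applyAt_apply, graphState_apply, edgeSign_localComplement]
  have hD : (∏ w, (if G.Adj v w then ![1, -Complex.I] else 1) (x w)) =
      (-Complex.I) ^ (onNeighbors G v x).card := by
    rw [← Finset.prod_const, ← Finset.prod_ite_mem_eq (onNeighbors G v x)]
    refine Finset.prod_congr rfl fun w _ => ?_
    by_cases h : G.Adj v w
    · rcases Fin.exists_fin_two.mp ⟨x w, rfl⟩ with h1 | h1 <;> simp [onNeighbors, h, h1]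
    · simp [onNeighbors, h]
  have hx : edgeSign G x = edgeSign (G.deleteIncidenceSet v) x *
      (if x v = 1 then (-1) ^ (onNeighbors G v x).card else 1) := by
    rw [← edgeSign_update, Function.update_eq_self]
  rw [hD, hx, ← phase_pow_mul_sqrtX, Fin.sum_univ_two, graphState_apply, graphState_apply,
    edgeSign_update, edgeSign_update]
  have h2 : ((-1 : ℂ) ^ (onNeighbors G v x).card) ^ 2 = 1 := by
    rw [← pow_mul, mul_comm, pow_mul]; norm_num
  -- The second row of `sqrtX` yields the first-row value times `(-1) ^ s`, which is the sign
  -- already present in `edgeSign G x` when `x v = 1`.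
  rcases Fin.exists_fin_two.mp ⟨x v, rfl⟩ with h | h
  · simp [sqrtX, h]
    ring
  · simp [sqrtX, h]
    linear_combination (-Complex.I) ^ (onNeighbors G v x).card *
      edgeSign (G.deleteIncidenceSet v) x * ((1 + Complex.I) / 2) * Complex.I *
      ((Real.sqrt 2 : ℂ) ^ Fintype.card V)⁻¹ * h2

theorem LocalCliffordEquivalent.refl [DecidableEq V] (ψ : QState V) :
    LocalCliffordEquivalent ψ ψ :=
  ⟨fun _ => 1, fun _ => isClifford_one, localOp_one ψ⟩

theorem LocalCliffordEquivalent.trans [DecidableEq V] {ψ φ χ : QState V}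
    (h₁ : LocalCliffordEquivalent ψ φ) (h₂ : LocalCliffordEquivalent φ χ) :
    LocalCliffordEquivalent ψ χ := by
  obtain ⟨A, hA, rfl⟩ := h₁
  obtain ⟨B, hB, rfl⟩ := h₂
  exact ⟨fun v => B v * A v, fun v => (hB v).mul (hA v), (localOp_mulVec_mulVec B A ψ).symm⟩

theorem LocallyEquivalent.localCliffordEquivalent [DecidableEq V] {G H : SimpleGraph V}
    (h : LocallyEquivalent G H) : LocalCliffordEquivalent (graphState G) (graphState H) := by
  induction h with
  | refl => exact .refl _
  | tail _ hs ih =>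
    obtain ⟨v, rfl⟩ := hs
    exact ih.trans ⟨_, isClifford_complementOp _ v, localOp_complementOp _ v⟩

end LocalComplement

/-! ### Extraction protocols for vertex-minors -/

section VertexMinor

variable {V : Type*}

theorem IsVertexMinor.mem_of_adj {G H : SimpleGraph V} {S : Set V} (h : IsVertexMinor G S H) :
    ∀ u w, H.Adj u w → u ∈ S := by
  induction h with
  | refl => simp
  | complement v hv h ih =>
    rintro u w ⟨_, h1 | h1⟩
    · exact ih _ _ h1.1
    · exact ih _ _ h1.1.1.symm
  | delete v hv h ih =>
    intro u w huw
    rw [SimpleGraph.deleteIncidenceSet_adj] at huw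
    exact ⟨ih _ _ huw.1, huw.2.1⟩

variable [Fintype V] [DecidableEq V]

theorem LocallyYields.of_localOp {T : QState V → Prop} {U : V → Matrix (Fin 2) (Fin 2) ℂ}
    (hU : ∀ v, IsClifford (U v)) {ψ : QState V} (h : LocallyYields T (localOp U *ᵥ ψ)) :
    LocallyYields T ψ := by
  -- Here `s` is the set of qubits not yet acted on: the induction removes gates one at a time, from
  -- all applied (empty `s`) to none.
  have key : ∀ s : Finset V,
      LocallyYields T (localOp (fun v => if v ∈ s then 1 else U v) *ᵥ ψ) := by
    intro s
    induction s using Finset.induction_on with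
    | empty => simpa using h
    | insert a s ha ih =>
      refine .clifford a (U a) (hU a) ?_
      rw [applyAt_localOp]
      convert ih using 3
      ext1 w
      by_cases hw : w = a
      · subst hw; simp [ha]
      · simp [hw]
  simpa [localOp_one] using key Finset.univ

open Classical in
/-- The factors of the projector onto the basis values `y` outside of `S`. -/
noncomputable def pinOp (S : Set V) (y : V → Fin 2) (v : V) : Matrix (Fin 2) (Fin 2) ℂ :=
  Matrix.diagonal (if v ∈ S then 1 else Pi.single (y v) 1)

/-- The projection of `ψ` onto the basis values `y` of the qubits outside of `S`. -/
noncomputable def pin (S : Set V) (y : V → Fin 2) (ψ : QState V) : QState V :=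
  localOp (pinOp S y) *ᵥ ψ

open Classical in
theorem pin_apply (S : Set V) (y : V → Fin 2) (ψ : QState V) (x : V → Fin 2) :
    pin S y ψ x = if ∀ v, v ∉ S → x v = y v then ψ x else 0 := by
  have h : pin S y ψ x = _ := localOp_diagonal _ ψ x
  rw [h]
  split_ifs with h
  · rw [Finset.prod_eq_one, one_mul]
    intro v _
    by_cases hv : v ∈ S
    · simp [hv]
    · simp [hv, h v hv]
  · push Not at h
    obtain ⟨v, hv, hxy⟩ := h
    rw [Finset.prod_eq_zero (Finset.mem_univ v), zero_mul]
    simp [hv, hxy]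

theorem pin_univ (y : V → Fin 2) (ψ : QState V) : pin Set.univ y ψ = ψ := by
  ext x; simp [pin_apply]

theorem localOp_pin {S : Set V} {U : V → Matrix (Fin 2) (Fin 2) ℂ} (hU : ∀ v, v ∉ S → U v = 1)
    (y : V → Fin 2) (ψ : QState V) :
    localOp U *ᵥ pin S y ψ = pin S y (localOp U *ᵥ ψ) := by
  rw [pin, pin, localOp_mulVec_mulVec, localOp_mulVec_mulVec]
  congr 2
  ext1 v
  by_cases hv : v ∈ S
  · simp [pinOp, hv]
  · simp [hU v hv]

/-- The basis value of a qubit that a measurement of `Z` with outcome `s` indicates. -/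
def outcomeBit (s : ℤˣ) : Fin 2 := if s = 1 then 0 else 1

theorem afterMeasurement_pin {S : Set V} {v : V} (hv : v ∈ S) (s : ℤˣ) (y : V → Fin 2)
    (ψ : QState V) :
    afterMeasurement v !![1, 0; 0, -1] s (pin S y ψ) =
      pin (S \ {v}) (Function.update y v (outcomeBit s)) ψ := by
  rw [afterMeasurement, pin, pin, applyAt_localOp]
  congr 2
  ext1 w
  by_cases hw : w = v
  · subst hw
    rcases Int.units_eq_one_or s with rfl | rfl <;>
    · ext i j
      fin_cases i <;> fin_cases j <;> simp [pinOp, hv, outcomeBit] <;> norm_num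
  · by_cases h : w ∈ S <;> simp [pinOp, hw, h]

open Classical in
/-- The Pauli corrections after a measurement of `Z` on the qubit `v` with basis value `i`. -/
noncomputable def correctionOp (G : SimpleGraph V) (v : V) (i : Fin 2) (w : V) :
    Matrix (Fin 2) (Fin 2) ℂ :=
  if G.Adj v w ∧ i = 1 then Matrix.diagonal ![1, -1] else 1

omit [Fintype V] [DecidableEq V] in
theorem isClifford_correctionOp (G : SimpleGraph V) (v : V) (i : Fin 2) (w : V) :
    IsClifford (correctionOp G v i w) := by
  unfold correctionOp
  split_ifs
  exacts [isClifford_pauliZ, isClifford_one]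

/-- Once `v` is fixed to `1`, its edges contribute only a sign for each neighbour carrying `1`,
which `Z` on the neighbours cancels; if `v` is fixed to `0` they contribute nothing. -/
theorem localOp_correctionOp_pin (G : SimpleGraph V) {S : Set V} {v : V} (hv : v ∉ S)
    (y : V → Fin 2) :
    localOp (correctionOp G v (y v)) *ᵥ pin S y (graphState G) =
      pin S y (graphState (G.deleteIncidenceSet v)) := by
  classical
  have hd : correctionOp G v (y v) =
      fun w => Matrix.diagonal (if G.Adj v w ∧ y v = 1 then ![1, -1] else 1) := by
    ext1 w
    by_cases h : G.Adj v w ∧ y v = 1 <;> simp [correctionOp, h]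
  rw [hd]
  ext x
  rw [localOp_diagonal, pin_apply, pin_apply]
  split_ifs with hx
  · rw [graphState_apply, graphState_apply, edgeSign_deleteIncidenceSet G v, hx v hv, ← mul_assoc,
      mul_left_comm, ← Finset.prod_mul_distrib, Finset.prod_eq_one, mul_one]
    intro w _
    by_cases h : G.Adj v w
    · rcases Fin.exists_fin_two.mp ⟨x w, rfl⟩ with h1 | h1 <;>
      rcases Fin.exists_fin_two.mp ⟨y v, rfl⟩ with h2 | h2 <;> simp [h, h1, h2, pairSign]
    · simp [h]
  · simp

/-- The hypothesis ranges over all `y` because deleted qubits are left in basis states given by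
random outcomes. A complementation acts only on `v` and its neighbours, which lie in `S`, so it
commutes with the projection. -/
theorem IsVertexMinor.locallyYields {T : QState V → Prop} {G H : SimpleGraph V} {S : Set V}
    (h : IsVertexMinor G S H) (hT : ∀ y, LocallyYields T (pin S y (graphState H))) :
    LocallyYields T (graphState G) := by
  induction h with
  | refl => simpa [pin_univ] using hT 0
  | @complement S H v hv h ih =>
    refine ih fun y => .of_localOp (isClifford_complementOp H v) ?_
    rw [localOp_pin, localOp_complementOp]
    · exact hT y
    · intro w hw
      have h1 : w ≠ v := fun h => hw (h ▸ hv)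
      have h2 : ¬ H.Adj v w := fun h' => hw (h.mem_of_adj _ _ h'.symm)
      simp [complementOp, h1, h2]
  | @delete S H v hv h ih =>
    refine ih fun y => .measure v _ (by simp [paulis] : !![1, 0; 0, -1] ∈ paulis) fun s _ => ?_
    rw [afterMeasurement_pin hv]
    refine .of_localOp (isClifford_correctionOp H v
      (Function.update y v (outcomeBit s) v)) ?_
    rw [localOp_correctionOp_pin _ (by simp)]
    exact hT _

end VertexMinor

/-! ### Bell pairs from the graph of two edges -/

section TwoEdges

theorem sum_hadamard_mul_pairSign (p q : Fin 2) :
    ∑ i, hadamard p i * pairSign i q = 2 * bell p q := by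
  fin_cases p <;> fin_cases q <;> simp [hadamard, pairSign, bell] <;> ring

variable {V : Type*} [Fintype V]

theorem edgeSign_twoEdges {a b c d : V} (hab : a ≠ b) (hcd : c ≠ d) (hac : a ≠ c) (had : a ≠ d)
    (x : V → Fin 2) :
    edgeSign (twoEdges a b c d) x = pairSign (x a) (x b) * pairSign (x c) (x d) := by
  classical
  rw [edgeSign, ← Finset.prod_filter]
  have h : Finset.univ.filter (fun e : Sym2 V => e ∈ (twoEdges a b c d).edgeSet) =
      {s(a, b), s(c, d)} := by
    ext e
    simp only [twoEdges, SimpleGraph.edgeSet_fromEdgeSet, Finset.mem_filter, Finset.mem_univ,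
      true_and, Set.mem_sdiff, Set.mem_insert_iff, Set.mem_singleton_iff, Finset.mem_insert,
      Finset.mem_singleton]
    constructor
    · exact fun h => h.1
    · rintro (rfl | rfl)
      · simpa using hab
      · simpa using hcd
  rw [h, Finset.prod_pair, czEntry_mk, czEntry_mk]
  simp [hac, had]

variable [DecidableEq V]

theorem hasBellPairs_pin_twoEdges {a b c d : V} (hab : a ≠ b) (hcd : c ≠ d) (hac : a ≠ c)
    (had : a ≠ d) (hbc : b ≠ c) (y : V → Fin 2) :
    HasBellPairs a b c d (applyAt c hadamard (applyAt a hadamard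
      (pin {a, b, c, d} y (graphState (twoEdges a b c d))))) := by
  classical
  have hk : (((1 / Real.sqrt 2 : ℝ) : ℂ) ^ Fintype.card V) ≠ 0 := by simp
  set k : ℂ := ((1 / Real.sqrt 2 : ℝ) : ℂ) ^ Fintype.card V with hk'
  -- Each of the two Hadamard sums gives `2 * bell`, hence the factor 4.
  refine ⟨fun z => if z = (fun v : {v : V // v ≠ a ∧ v ≠ b ∧ v ≠ c ∧ v ≠ d} => y v)
    then 4 * k else 0, ?_, fun x => ?_⟩
  · intro h
    simpa [hk] using congrFun h fun v => y v
  · have hpin : ∀ i j, pin {a, b, c, d} y (graphState (twoEdges a b c d))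
        (Function.update (Function.update x c i) a j) =
        if (fun v : {v : V // v ≠ a ∧ v ≠ b ∧ v ≠ c ∧ v ≠ d} => x v) = (fun v : {v : V // v ≠ a ∧ v ≠ b ∧ v ≠ c ∧ v ≠ d} => y v)
        then pairSign j (x b) * pairSign i (x d) * k else 0 := by
      intro i j
      rw [pin_apply, graphState_apply, edgeSign_twoEdges hab hcd hac had]
      congr 1
      · simp only [eq_iff_iff, funext_iff, Subtype.forall]
        refine forall_congr' fun v => ?_
        simp only [Set.mem_insert_iff, Set.mem_singleton_iff, not_or]
        refine forall_congr' fun hv => ?_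
        rw [Function.update_of_ne hv.1, Function.update_of_ne hv.2.2.1]
      · rw [← hk']
        simp [hab.symm, hbc, hac.symm, had.symm, hcd.symm]
    simp only [applyAt_apply, hpin]
    split_ifs
    · have h1 := sum_hadamard_mul_pairSign (x a) (x b)
      have h2 := sum_hadamard_mul_pairSign (x c) (x d)
      simp only [Fin.sum_univ_two, Function.update_of_ne hac] at *
      linear_combination k * (hadamard (x c) 0 * pairSign 0 (x d) +
        hadamard (x c) 1 * pairSign 1 (x d)) * h1 + k * 2 * bell (x a) (x b) * h2
    · simp

theorem IsVertexMinor.bellPairsExtractable {G : SimpleGraph V} {a b c d : V}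
    (hab : a ≠ b) (hcd : c ≠ d) (hac : a ≠ c) (had : a ≠ d) (hbc : b ≠ c)
    (h : IsVertexMinor G {a, b, c, d} (twoEdges a b c d)) :
    BellPairsExtractable a b c d (graphState G) :=
  h.locallyYields fun y => .clifford a _ isClifford_hadamard <| .clifford c _ isClifford_hadamard <|
    .done <| hasBellPairs_pin_twoEdges hab hcd hac had hbc y

end TwoEdges

/-! ### Branches of protocols as local operators -/

section Branches

variable {V : Type*} [Fintype V]

theorem graphState_ne_zero (G : SimpleGraph V) : graphState G ≠ 0 := by
  classical
  intro h
  have h0 := congrFun h 0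
  rw [graphState_apply] at h0
  have h1 : edgeSign G 0 ≠ 0 := by
    refine Finset.prod_ne_zero_iff.mpr fun e _ => ?_
    split_ifs
    · exact left_ne_zero_of_mul_eq_one (czEntry_mul_self e 0)
    · exact one_ne_zero
  simp [h1] at h0

variable [DecidableEq V]

theorem LocallyYields.exists_localOp {T : QState V → Prop} {ψ : QState V}
    (h : LocallyYields T ψ) (hψ : ψ ≠ 0) :
    ∃ K : V → Matrix (Fin 2) (Fin 2) ℂ, T (localOp K *ᵥ ψ) := by
  induction h with
  | @done ψ h => exact ⟨fun _ => 1, by rwa [localOp_one]⟩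
  | @clifford ψ v U hU h ih =>
    have hne : applyAt v U ψ ≠ 0 := by
      intro h0
      have h1 : applyAt v Uᴴ (applyAt v U ψ) = ψ := by
        have hUU : Uᴴ * U = 1 := Matrix.mem_unitaryGroup_iff'.mp hU.1
        conv_lhs => rw [applyAt, applyAt, localOp_mulVec_mulVec]
        conv_rhs => rw [← localOp_one ψ]
        congr 2
        ext1 w
        by_cases hw : w = v
        · subst hw; simp [hUU]
        · simp [hw]
      rw [h0] at h1
      exact hψ (by rw [← h1, applyAt, Matrix.mulVec_zero])
    obtain ⟨K, hK⟩ := ih hne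
    rw [applyAt, localOp_mulVec_mulVec] at hK
    exact ⟨_, hK⟩
  | @measure ψ v P hP h ih =>
    -- The projectors of the two outcomes sum to the identity, so they cannot both annihilate `ψ`.
    have hs : ∃ s, afterMeasurement v P s ψ ≠ 0 := by
      by_contra! h0
      apply hψ
      ext x
      have h1 := congrFun (h0 1) x
      have h2 := congrFun (h0 (-1)) x
      have h3 : applyAt v 1 ψ x = ψ x := by
        rw [applyAt, ← Pi.one_apply (M := fun _ : V => Matrix (Fin 2) (Fin 2) ℂ) v,
          Function.update_eq_self_iff.mpr rfl]
        exact congrFun (localOp_one ψ) x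
      rw [← h3]
      simp only [afterMeasurement, applyAt_apply, Matrix.smul_apply, Matrix.add_apply, smul_eq_mul,
        Pi.zero_apply, Fin.sum_univ_two] at h1 h2 ⊢
      push_cast at h1 h2
      linear_combination h1 + h2
    obtain ⟨s, hs⟩ := hs
    obtain ⟨K, hK⟩ := ih s hs hs
    rw [afterMeasurement, applyAt, localOp_mulVec_mulVec] at hK
    exact ⟨_, hK⟩

theorem LocalCliffordEquivalent.exists_localOp {ψ φ : QState V}
    (h : LocalCliffordEquivalent ψ φ) (K : V → Matrix (Fin 2) (Fin 2) ℂ) :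
    ∃ L : V → Matrix (Fin 2) (Fin 2) ℂ, localOp L *ᵥ φ = localOp K *ᵥ ψ := by
  obtain ⟨U, hU, rfl⟩ := h
  refine ⟨fun v => K v * (U v)ᴴ, ?_⟩
  rw [localOp_mulVec_mulVec]
  congr 2
  ext1 v
  have hUU : (U v)ᴴ * U v = 1 := Matrix.mem_unitaryGroup_iff'.mp (hU v).1
  rw [Matrix.mul_assoc, hUU, mul_one]

end Branches

/-! ### Separated pairs of qubits -/

section Separation

variable {V : Type*} [DecidableEq V]

/-- Given the values of the qubits `c` and `d`, the amplitudes of `ψ` factor into a part that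
depends on the qubits in `B` and a part that depends on the other qubits. -/
def Exchangeable (c d : V) (B : Finset V) (ψ : QState V) : Prop :=
  ∀ z z', z c = z' c → z d = z' d →
    ψ z * ψ z' = ψ (B.piecewise z' z) * ψ (B.piecewise z z')

variable [Fintype V]

/-- No edge joins `B` to the outside except through `c` or `d`, where `z` and `z'` agree. So the
exchange on `B` either swaps the two signs of an edge or leaves both unchanged. -/
theorem exchangeable_graphState {R : SimpleGraph V} {c d : V} {B : Finset V}
    (hB : ∀ u w, R.Adj u w → u ∈ B → w ∈ B ∨ w = c ∨ w = d) :
    Exchangeable c d B (graphState R) := by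
  classical
  intro z z' hc hd
  have h : edgeSign R z * edgeSign R z' =
      edgeSign R (B.piecewise z' z) * edgeSign R (B.piecewise z z') := by
    simp only [edgeSign]
    rw [← Finset.prod_mul_distrib, ← Finset.prod_mul_distrib]
    refine Finset.prod_congr rfl fun e _ => ?_
    induction e with | _ u w => ?_
    split_ifs with he
    · simp only [czEntry_mk]
      have hu := hB u w he
      have hw := hB w u he.symm
      have hv : ∀ v, v ∈ B ∨ v = c ∨ v = d →
          B.piecewise z' z v = z' v ∧ B.piecewise z z' v = z v := by
        intro v hv
        by_cases hvB : v ∈ B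
        · simp [hvB]
        · rcases hv with hv | rfl | rfl
          · exact absurd hv hvB
          · simp [hvB, hc]
          · simp [hvB, hd]
      by_cases h1 : u ∈ B
      · rw [(hv u (.inl h1)).1, (hv u (.inl h1)).2, (hv w (hu h1)).1, (hv w (hu h1)).2, mul_comm]
      · by_cases h2 : w ∈ B
        · rw [(hv w (.inl h2)).1, (hv w (.inl h2)).2, (hv u (hw h2)).1, (hv u (hw h2)).2, mul_comm]
        · simp [h1, h2]
    · rfl
  simp only [graphState_apply]
  linear_combination (((1 / Real.sqrt 2 : ℝ) : ℂ) ^ Fintype.card V) ^ 2 * h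

theorem Exchangeable.localOp {c d : V} {B : Finset V} {ψ : QState V} (h : Exchangeable c d B ψ) {K : V → Matrix (Fin 2) (Fin 2) ℂ} (hc : K c = 1) (hd : K d = 1) :
    Exchangeable c d B (localOp K *ᵥ ψ) := by
  intro x x' hxc hxd
  have key : ∀ p q r s : QState V,
      (∑ z, p z * q z) * (∑ z, r z * s z) =
        ∑ z : (V → Fin 2) × (V → Fin 2), (p z.1 * r z.2) * (q z.1 * s z.2) := by
    intro p q r s
    rw [Finset.sum_mul_sum, ← Finset.univ_product_univ, Finset.sum_product]
    exact Finset.sum_congr rfl fun _ _ => Finset.sum_congr rfl fun _ _ => by ring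
  simp only [QNet.localOp, Matrix.mulVec, dotProduct, Matrix.of_apply]
  rw [key, key]
  have hinv : ∀ z z' : V → Fin 2, B.piecewise (B.piecewise z z') (B.piecewise z' z) = z := by
    intro z z'
    ext v
    by_cases hv : v ∈ B <;> simp [hv]
  -- Exchanging the two summation indices on `B` is an involution that matches the terms of the two
  -- double sums.
  let σ : (V → Fin 2) × (V → Fin 2) ≃ (V → Fin 2) × (V → Fin 2) :=
    { toFun := fun z => (B.piecewise z.2 z.1, B.piecewise z.1 z.2)
      invFun := fun z => (B.piecewise z.2 z.1, B.piecewise z.1 z.2)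
      left_inv := fun z => Prod.ext (hinv _ _) (hinv _ _)
      right_inv := fun z => Prod.ext (hinv _ _) (hinv _ _) }
  refine Fintype.sum_equiv σ _ _ ?_
  rintro ⟨z, z'⟩
  have hw : (∏ v, K v (x v) (z v)) * (∏ v, K v (x' v) (z' v)) =
      (∏ v, K v (B.piecewise x' x v) (B.piecewise z' z v)) *
        (∏ v, K v (B.piecewise x x' v) (B.piecewise z z' v)) := by
    rw [← Finset.prod_mul_distrib, ← Finset.prod_mul_distrib]
    refine Finset.prod_congr rfl fun v _ => ?_
    by_cases hv : v ∈ B <;> simp [hv, mul_comm]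
  change (∏ v, K v (x v) (z v)) * (∏ v, K v (x' v) (z' v)) * (ψ z * ψ z') =
    (∏ v, K v (B.piecewise x' x v) (B.piecewise z' z v)) *
      (∏ v, K v (B.piecewise x x' v) (B.piecewise z z' v)) *
        (ψ (B.piecewise z' z) * ψ (B.piecewise z z'))
  rw [← hw]
  -- A nonzero weight forces `z`, `z'` to equal `x`, `x'` at `c` and `d`, where `K` is the identity;
  -- so the hypothesis on `ψ` applies.
  by_cases h0 : (∏ v, K v (x v) (z v)) * (∏ v, K v (x' v) (z' v)) = 0
  · rw [h0, zero_mul, zero_mul]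
  · have h1 : ∀ v, K v = 1 → x v = z v ∧ x' v = z' v := by
      intro v hv
      have h2 := Finset.prod_ne_zero_iff.mp (left_ne_zero_of_mul h0) v (Finset.mem_univ v)
      have h3 := Finset.prod_ne_zero_iff.mp (right_ne_zero_of_mul h0) v (Finset.mem_univ v)
      rw [hv] at h2 h3
      exact ⟨by_contra fun h => h2 (Matrix.one_apply_ne h),
        by_contra fun h => h3 (Matrix.one_apply_ne h)⟩
    rw [h z z' (by rw [← (h1 c hc).1, ← (h1 c hc).2, hxc])
      (by rw [← (h1 d hd).1, ← (h1 d hd).2, hxd])]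

/-- A row vector `w` with `w * K c = 0` annihilates the output at qubit `c`; since each basis vector
of that qubit occurs there as a slice up to a scalar, `w` would vanish. -/
theorem det_ne_zero_of_localOp {K : V → Matrix (Fin 2) (Fin 2) ℂ} {ψ : QState V} {c : V}
    (h : ∀ j, ∃ x, ∃ k : ℂ, k ≠ 0 ∧ ∀ i, (localOp K *ᵥ ψ) (Function.update x c i) =
      if i = j then k else 0) : (K c).det ≠ 0 := by
  intro hdet
  obtain ⟨w, hw, hwK⟩ := Matrix.exists_vecMul_eq_zero_iff.mpr hdet
  obtain ⟨j, hj⟩ := Function.ne_iff.mp hw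
  obtain ⟨x, k, hk, hx⟩ := h j
  have hM : (Matrix.of fun _ : Fin 2 => w) * K c = 0 := by
    ext i l
    exact congrFun hwK l
  have h0 : applyAt c (Matrix.of fun _ => w) (localOp K *ᵥ ψ) x = 0 := by
    rw [applyAt_localOp, hM]
    simp only [localOp, Matrix.mulVec, dotProduct, Matrix.of_apply]
    refine Finset.sum_eq_zero fun z _ => ?_
    rw [Finset.prod_eq_zero (Finset.mem_univ c), zero_mul]
    simp
  rw [applyAt_apply] at h0
  simp only [hx, Matrix.of_apply] at h0
  simp at h0
  tauto

theorem not_hasBellPairs_of_exchangeable {a b c d : V} (hab : a ≠ b) (hcd : c ≠ d) (hac : a ≠ c)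
    (had : a ≠ d) (hbc : b ≠ c) (hbd : b ≠ d) {B : Finset V} (ha : a ∉ B) (hb : b ∈ B)
    {ψ : QState V} (hψ : Exchangeable c d B ψ)
    (K : V → Matrix (Fin 2) (Fin 2) ℂ) : ¬ HasBellPairs a b c d (localOp K *ᵥ ψ) := by
  rintro ⟨χ, hχ, hbell⟩
  obtain ⟨y, hy⟩ := Function.ne_iff.mp hχ
  have hy : χ y ≠ 0 := hy
  let pt : Fin 2 → Fin 2 → Fin 2 → Fin 2 → V → Fin 2 := fun p q r s v =>
    if v = a then p else if v = b then q else if v = c then r else if v = d then s else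
      if h : v ≠ a ∧ v ≠ b ∧ v ≠ c ∧ v ≠ d then y ⟨v, h⟩ else 0
  have hpt : ∀ p q r s, (localOp K *ᵥ ψ) (pt p q r s) = bell p q * bell r s * χ y := by
    intro p q r s
    rw [hbell]
    have hz : (fun v : {v : V // v ≠ a ∧ v ≠ b ∧ v ≠ c ∧ v ≠ d} => pt p q r s v) = y := by
      ext ⟨v, hv⟩
      simp [pt, hv]
    rw [hz]
    simp [pt, hab.symm, hac.symm, had.symm, hbc.symm, hbd.symm, hcd.symm]
  have hptc : ∀ p q r s i, Function.update (pt p q r s) c i = pt p q i s := by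
    intro p q r s i
    ext1 v
    by_cases hv : v = c
    · subst hv; simp [pt, hac.symm, hbc.symm]
    · simp [pt, hv]
  have hptd : ∀ p q r s i, Function.update (pt p q r s) d i = pt p q r i := by
    intro p q r s i
    ext1 v
    by_cases hv : v = d
    · subst hv; simp [pt, had.symm, hbd.symm, hcd.symm]
    · simp [pt, hv]
  have hb0 : bell 0 0 ≠ 0 := by simp [bell]
  have hbij : ∀ i j, bell i j = if i = j then bell 0 0 else 0 := by simp [bell]
  have hKc : (K c).det ≠ 0 := det_ne_zero_of_localOp (ψ := ψ) fun j =>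
    ⟨pt 0 0 0 j, bell 0 0 * bell 0 0 * χ y, mul_ne_zero (mul_ne_zero hb0 hb0) hy, fun i => by
      rw [hptc, hpt, hbij i j]; split_ifs <;> simp⟩
  have hKd : (K d).det ≠ 0 := det_ne_zero_of_localOp (ψ := ψ) fun j =>
    ⟨pt 0 0 j 0, bell 0 0 * bell 0 0 * χ y, mul_ne_zero (mul_ne_zero hb0 hb0) hy, fun i => by
      rw [hptd, hpt, hbij j i]; simp only [eq_comm]; split_ifs <;> simp⟩
  -- Undoing `K c` and `K d` makes the total operator trivial on `c` and `d`. The Bell factor on `a,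
  -- b` survives, and the one on `c, d` becomes an invertible matrix.
  let φ := applyAt c (K c)⁻¹ (applyAt d (K d)⁻¹ (localOp K *ᵥ ψ))
  have hφ : ∀ p q r s, φ (pt p q r s) =
      bell p q * (bell 0 0 * χ y) * ((K c)⁻¹ * ((K d)⁻¹)ᵀ) r s := by
    intro p q r s
    have h1 : pt p q r s c = r := by simp [pt, hac.symm, hbc.symm]
    have h2 : ∀ i, pt p q i s d = s := by simp [pt, had.symm, hbd.symm, hcd.symm]
    simp only [φ, applyAt_apply, hptc, hptd, hpt, h1, h2, Matrix.mul_apply, Matrix.transpose_apply,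
      Fin.sum_univ_two, hbij 0 1, hbij 1 0, hbij 1 1]
    simp
    ring
  have hex : Exchangeable c d B φ := by
    simp only [φ, applyAt_localOp]
    refine hψ.localOp ?_ ?_
    · rw [Function.update_self, Function.update_of_ne hcd,
        Matrix.nonsing_inv_mul _ (isUnit_iff_ne_zero.mpr hKc)]
    · rw [Function.update_of_ne hcd.symm, Function.update_self,
        Matrix.nonsing_inv_mul _ (isUnit_iff_ne_zero.mpr hKd)]
  have hM : (K c)⁻¹ * ((K d)⁻¹)ᵀ ≠ 0 := by
    intro h
    have h1 := congrArg Matrix.det h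
    simp [Matrix.det_mul, Matrix.det_nonsing_inv, hKc, hKd] at h1
  obtain ⟨r, s, hrs⟩ : ∃ r s, ((K c)⁻¹ * ((K d)⁻¹)ᵀ) r s ≠ 0 := by
    by_contra! h
    exact hM (Matrix.ext h)
  have hsw : ∀ p q : Fin 2, B.piecewise (pt q q r s) (pt p p r s) = pt p q r s := by
    intro p q
    ext1 v
    by_cases hva : v = a
    · subst hva; simp [ha, pt]
    · by_cases hvb : v = b
      · subst hvb; simp [hb, pt, hva]
      · by_cases hvB : v ∈ B <;> simp [hvB, pt, hva, hvb]
  -- As `B` contains `b` but not `a`, the exchange turns the values `00`, `11` of `a, b` into `01`,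
  -- `10`: a nonzero product would equal zero.
  have h := hex (pt 0 0 r s) (pt 1 1 r s) (by simp [pt, hac.symm, hbc.symm])
    (by simp [pt, had.symm, hbd.symm, hcd.symm])
  rw [hsw, hsw, hφ, hφ, hφ, hφ, hbij 0 1, hbij 1 0, hbij 1 1] at h
  simp [hb0, hy, hrs] at h

end Separation

/-! ### Decidable adjacency -/

section Decidable

variable {V : Type*} [DecidableEq V]

instance (G : SimpleGraph V) [DecidableRel G.Adj] (v : V) :
    DecidableRel (localComplement G v).Adj := fun a b =>
  inferInstanceAs (Decidable (a ≠ b ∧ ((G.Adj a b ∧ ¬(G.Adj v a ∧ G.Adj v b)) ∨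
    ((G.Adj v a ∧ G.Adj v b) ∧ ¬ G.Adj a b))))

instance (G : SimpleGraph V) [DecidableRel G.Adj] (v : V) :
    DecidableRel (G.deleteIncidenceSet v).Adj := fun _ _ =>
  decidable_of_iff _ SimpleGraph.deleteIncidenceSet_adj.symm

instance (a b c d : V) : DecidableRel (twoEdges a b c d).Adj := fun u w =>
  decidable_of_iff ((s(u, w) = s(a, b) ∨ s(u, w) = s(c, d)) ∧ u ≠ w) (by simp [twoEdges])

instance (n : ℕ) : DecidableRel (grid n).Adj := fun u w =>
  decidable_of_iff (((u.1.val + 1 = w.1.val ∨ w.1.val + 1 = u.1.val) ∧ u.2 = w.2) ∨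
    ((u.2.val + 1 = w.2.val ∨ w.2.val + 1 = u.2.val) ∧ u.1 = w.1))
    (by rw [grid, SimpleGraph.boxProd_adj, SimpleGraph.pathGraph_adj, SimpleGraph.pathGraph_adj])

end Decidable

/-! ### The ring in the local orbit of the `2 × 4` grid -/

/-- The cyclic order of the vertices of the `2 × 4` grid along the ring. -/
def ringOrder : Fin 8 ≃ Fin 4 × Fin 2 where
  toFun := ![(0, 0), (0, 1), (1, 0), (2, 0), (3, 1), (3, 0), (2, 1), (1, 1)]
  invFun v := ![![0, 1], ![2, 7], ![3, 6], ![5, 4]] v.1 v.2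
  left_inv := by decide
  right_inv := by decide

/-- The ring graph with the vertices in the order `ringOrder`. -/
def gridRing : SimpleGraph (Fin 4 × Fin 2) :=
  (SimpleGraph.cycleGraph 8).comap ringOrder.symm

theorem gridRing_adj (u w : Fin 4 × Fin 2) :
    gridRing.Adj u w ↔ ringOrder.symm u - ringOrder.symm w = 1 ∨
      ringOrder.symm w - ringOrder.symm u = 1 :=
  SimpleGraph.cycleGraph_adj

instance : DecidableRel gridRing.Adj := fun u w => decidable_of_iff _ (gridRing_adj u w).symm

theorem isRing_gridRing : IsRing 8 gridRing :=
  ⟨(SimpleGraph.Iso.comap ringOrder.symm (SimpleGraph.cycleGraph 8)).symm⟩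

-- Each triple of complementations is a pivot on an end rung: it removes the adjacent inner rung and
-- interchanges the two corners, leaving an 8-cycle.
set_option synthInstance.maxSize 2000 in
theorem localComplement_grid_four :
    localComplement (localComplement (localComplement (localComplement (localComplement
      (localComplement (grid 4) (0, 0)) (0, 1)) (0, 0)) (3, 0)) (3, 1)) (3, 0) = gridRing := by
  ext u w
  revert u w
  decide +kernel

theorem locallyEquivalent_grid_four : LocallyEquivalent (grid 4) gridRing := by
  rw [← localComplement_grid_four]
  exact .tail (.tail (.tail (.tail (.tail (.tail .refl ⟨_, rfl⟩) ⟨_, rfl⟩) ⟨_, rfl⟩) ⟨_, rfl⟩)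
    ⟨_, rfl⟩) ⟨_, rfl⟩

theorem mem_edges_of_cut {V : Type*} {G : SimpleGraph V} {a b : V}
    (p : G.Walk a b) (S : Set V) {e e' : Sym2 V} (ha : a ∈ S) (hb : b ∉ S)
    (hS : ∀ u w, G.Adj u w → u ∈ S → w ∉ S → s(u, w) = e ∨ s(u, w) = e') :
    e ∈ p.edges ∨ e' ∈ p.edges := by
  obtain ⟨d, hd, h1, h2⟩ := p.exists_boundary_dart S ha hb
  have hde : d.edge ∈ p.edges := List.mem_map_of_mem hd
  rcases hS _ _ d.adj h1 h2 with rfl | rfl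
  · exact .inl hde
  · exact .inr hde

theorem mem_edges_of_gridRing_cut {a b : Fin 4 × Fin 2} (p : gridRing.Walk a b)
    (S : Finset (Fin 8)) {e e' : Sym2 (Fin 4 × Fin 2)} (ha : ringOrder.symm a ∈ S)
    (hb : ringOrder.symm b ∉ S)
    (hS : ∀ u w, gridRing.Adj u w → ringOrder.symm u ∈ S → ringOrder.symm w ∉ S →
      s(u, w) = e ∨ s(u, w) = e') :
    e ∈ p.edges ∨ e' ∈ p.edges :=
  mem_edges_of_cut p {v | ringOrder.symm v ∈ S} ha hb hS

/-- Only the four edges at the ends of the second pair matter. Two edges cut the ring into arcs, and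
a walk between different arcs uses one of them. These cuts force `p` to contain `e₁, e₂` or `e₃,
e₄`, and `q` to contain `e₂, e₃` or `e₁, e₄`; any two of these choices share an edge. -/
theorem pairsCross_gridRing : PairsCross gridRing (0, 0) (3, 1) (0, 1) (3, 0) := by
  intro p q _ _
  let e₁ : Sym2 (Fin 4 × Fin 2) := s((0, 0), (0, 1))
  let e₂ : Sym2 (Fin 4 × Fin 2) := s((0, 1), (1, 0))
  let e₃ : Sym2 (Fin 4 × Fin 2) := s((3, 1), (3, 0))
  let e₄ : Sym2 (Fin 4 × Fin 2) := s((3, 0), (2, 1))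
  have p₁₃ : e₁ ∈ p.edges ∨ e₃ ∈ p.edges :=
    mem_edges_of_gridRing_cut p {5, 6, 7, 0} (by decide) (by decide) (by decide)
  have p₁₄ : e₁ ∈ p.edges ∨ e₄ ∈ p.edges :=
    mem_edges_of_gridRing_cut p {6, 7, 0} (by decide) (by decide) (by decide)
  have p₂₃ : e₂ ∈ p.edges ∨ e₃ ∈ p.edges :=
    mem_edges_of_gridRing_cut p {5, 6, 7, 0, 1} (by decide) (by decide) (by decide)
  have p₂₄ : e₂ ∈ p.edges ∨ e₄ ∈ p.edges :=
    mem_edges_of_gridRing_cut p {6, 7, 0, 1} (by decide) (by decide) (by decide)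
  have q₁₂ : e₁ ∈ q.edges ∨ e₂ ∈ q.edges :=
    mem_edges_of_gridRing_cut q {1} (by decide) (by decide) (by decide)
  have q₃₄ : e₃ ∈ q.edges ∨ e₄ ∈ q.edges :=
    mem_edges_of_gridRing_cut q {6, 7, 0, 1, 2, 3, 4} (by decide) (by decide) (by decide)
  have q₁₃ : e₁ ∈ q.edges ∨ e₃ ∈ q.edges :=
    mem_edges_of_gridRing_cut q {1, 2, 3, 4} (by decide) (by decide) (by decide)
  have q₂₄ : e₂ ∈ q.edges ∨ e₄ ∈ q.edges :=
    mem_edges_of_gridRing_cut q {6, 7, 0, 1} (by decide) (by decide) (by decide)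
  clear_value e₁ e₂ e₃ e₄
  by_contra! h
  have h₁ := h e₁
  have h₂ := h e₂
  have h₃ := h e₃
  have h₄ := h e₄
  grind

set_option synthInstance.maxSize 2000 in
theorem not_hasBellPairs_grid_four (K : Fin 4 × Fin 2 → Matrix (Fin 2) (Fin 2) ℂ) :
    ¬ HasBellPairs (0, 0) (3, 1) (0, 1) (3, 0) (localOp K *ᵥ graphState (grid 4)) := by
  obtain ⟨L, hL⟩ := locallyEquivalent_grid_four.localCliffordEquivalent.exists_localOp K
  rw [← hL]
  -- `B` is the open arc of the ring between `(0, 1)` and `(3, 0)` that contains `(3, 1)`.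
  exact not_hasBellPairs_of_exchangeable (by decide) (by decide) (by decide) (by decide)
    (by decide) (by decide) (B := {(1, 0), (2, 0), (3, 1)}) (by decide) (by decide)
    (exchangeable_graphState (by decide)) L

theorem not_bellPairsExtractable_grid_four :
    ¬ BellPairsExtractable (0, 0) (3, 1) (0, 1) (3, 0) (graphState (grid 4)) := by
  intro h
  obtain ⟨K, hK⟩ := h.exists_localOp (graphState_ne_zero _)
  exact not_hasBellPairs_grid_four K hK

/-! ### The butterfly network -/

set_option synthInstance.maxSize 2000 in
theorem localComplement_grid_three :
    ((localComplement (localComplement (localComplement (grid 3) (0, 0)) (1, 0))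
      (1, 1)).deleteIncidenceSet (1, 0)).deleteIncidenceSet (1, 1) =
      twoEdges (0, 0) (2, 1) (0, 1) (2, 0) := by
  ext u w
  revert u w
  decide +kernel

theorem isVertexMinor_grid_three :
    IsVertexMinor (grid 3) {(0, 0), (2, 1), (0, 1), (2, 0)}
      (twoEdges (0, 0) (2, 1) (0, 1) (2, 0)) := by
  have hS : ({(0, 0), (2, 1), (0, 1), (2, 0)} : Set (Fin 3 × Fin 2)) =
      (Set.univ \ {(1, 0)}) \ {(1, 1)} := by
    ext v
    simp only [Set.mem_insert_iff, Set.mem_singleton_iff, Set.mem_sdiff, Set.mem_univ, true_and]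
    revert v
    decide
  rw [hS, ← localComplement_grid_three]
  exact .delete _ (by simp) <| .delete _ trivial <| .complement _ trivial <|
    .complement _ trivial <| .complement _ trivial .refl

end QNet

/-- In `grid 4` the vertices with the labels `1, 2, 7, 8` are `(0, 0), (0, 1), (3, 0), (3, 1)`; in
`grid 3` the vertices with the labels `1, 2, 5, 6` are `(0, 0), (0, 1), (2, 0), (2, 1)`. -/
theorem mainTheorem3 :
    -- the 2 x 4 grid is locally equivalent to a ring in which the pairs 1,8 and 2,7 cross
    (∃ R : SimpleGraph (Fin 4 × Fin 2),
      IsRing 8 R ∧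
      LocallyEquivalent (grid 4) R ∧
      LocalCliffordEquivalent (graphState (grid 4)) (graphState R) ∧
      PairsCross R (0, 0) (3, 1) (0, 1) (3, 0)) ∧
    -- Bell pairs between 1,8 and 2,7 cannot be extracted simultaneously from the 2 x 4 grid:
    -- not by local complementations and vertex deletions,
    (¬ IsVertexMinor (grid 4) {(0, 0), (3, 1), (0, 1), (3, 0)}
        (twoEdges (0, 0) (3, 1) (0, 1) (3, 0))) ∧
    -- not by local Clifford operations, local Pauli measurements and classical communication,
    (¬ BellPairsExtractable (0, 0) (3, 1) (0, 1) (3, 0) (graphState (grid 4))) ∧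
    -- and not in any branch of any local protocol, so not even with some positive probability
    (∀ K : Fin 4 × Fin 2 → Matrix (Fin 2) (Fin 2) ℂ,
      ¬ HasBellPairs (0, 0) (3, 1) (0, 1) (3, 0) (localOp K *ᵥ graphState (grid 4))) ∧
    -- whereas for the butterfly network (2 x 3 grid) and the pairs 1,6 and 2,5 it is possible
    IsVertexMinor (grid 3) {(0, 0), (2, 1), (0, 1), (2, 0)}
      (twoEdges (0, 0) (2, 1) (0, 1) (2, 0)) ∧
    BellPairsExtractable (0, 0) (2, 1) (0, 1) (2, 0) (graphState (grid 3)) := by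
  refine ⟨⟨gridRing, isRing_gridRing, locallyEquivalent_grid_four,
    locallyEquivalent_grid_four.localCliffordEquivalent, pairsCross_gridRing⟩, fun h => ?_,
    not_bellPairsExtractable_grid_four, not_hasBellPairs_grid_four, isVertexMinor_grid_three, ?_⟩
  · exact not_bellPairsExtractable_grid_four (h.bellPairsExtractable (by decide) (by decide)
      (by decide) (by decide) (by decide))
  · exact isVertexMinor_grid_three.bellPairsExtractable (by decide) (by decide) (by decide)
      (by decide) (by decide)
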